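/- Let $d,m\ge 0$ and $n\ge 1$ be integers, let $\Sigma\in\mathbb R^{d\times d}$ be a fixed (known) positive definite covariance matrix, and let $\mathcal P=\{\mathcal N(\theta,\Sigma):\theta\in\mathbb R^d\}$ be the Gaussian location model. For probability measures write $\|P-Q\|_{\mathrm{TV}}=\frac12\int|dP-dQ|$, and define the minimax error of sample amplification from $n$ to $n+m$ samples by $$\varepsilon^\star(\mathcal P,n,m)=\inf_T\sup_{P\in\mathcal P}\left\|P^{\otimes(n+m)}-P^{\otimes n}\circ T^{-1}\right\|_{\mathrm{TV}},$$ where the infimum is over all randomized measurable maps (Markov kernels) $T$ from $(\mathbb R^d)^n$ to $(\mathbb R^d)^{n+m}$ and $P^{\otimes n}\circ T^{-1}$ is the law of the output of $T$ when its input has law $P^{\otimes n}$. Then $$\varepsilon^\star(\mathcal P,n,m)=\left\|\mathcal N\left(0,\tfrac{I_d}{n}\right)-\mathcal N\left(0,\tfrac{I_d}{n+m}\right)\right\|_{\mathrm{TV}}.$$ In particular, the following sufficiency-based procedure is exactly minimax optimal: given $X_1,\dots,X_n$, compute the sample mean $t=\frac1n\sum_{i=1}^nX_i$ and output $(\widehat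 X_1,\dots,\widehat X_{n+m})$ drawn from the conditional distribution of $n+m$ i.i.d. samples from $\mathcal N(\theta_0,\Sigma)$ given that their sample mean equals $t$. That is, there is a version of this conditional distribution that does not depend on $\theta_0\in\mathbb R^d$, and for every $\theta_0$ and every version (Markov kernel) of the conditional distribution under $\mathcal N(\theta_0,\Sigma)^{\otimes(n+m)}$, the worst-case total variation error over $\mathcal P$ of the resulting procedure equals $\varepsilon^\star(\mathcal P,n,m)$. -/

import Mathlib

open MeasureTheory ProbabilityTheory
open scoped ENNReal

noncomputable section

namespace SampleAmplification

/-- Total variation distance `½ ∫ |dP - dQ|`, i.e. half of the total mass of the variation measure of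
the signed measure `P - Q`. -/
def tvDist {Ω : Type*} [MeasurableSpace Ω] (P Q : Measure Ω) [IsFiniteMeasure P]
    [IsFiniteMeasure Q] : ℝ≥0∞ :=
  (P.toSignedMeasure - Q.toSignedMeasure).totalVariation Set.univ / 2

/-- The law `P^{⊗ n}` of `n` i.i.d. samples from `P`. -/
abbrev iidLaw {X : Type*} [MeasurableSpace X] (P : ProbabilityMeasure X) (n : ℕ) :
    Measure (Fin n → X) :=
  Measure.pi fun _ => (P : Measure X)

/-- Worst-case error over the class `𝓟` of the randomized map `T` from `n` to `n + m` samples.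
A randomized map is a Markov kernel; `T ∘ₘ μ` is the law of its output when its input has law `μ`. -/
def amplificationError {X : Type*} [MeasurableSpace X] (𝓟 : Set (ProbabilityMeasure X)) {n m : ℕ}
    (T : Kernel (Fin n → X) (Fin (n + m) → X)) [IsMarkovKernel T] : ℝ≥0∞ :=
  ⨆ P ∈ 𝓟, tvDist (iidLaw P (n + m)) (T ∘ₘ iidLaw P n)

/-- The minimax error of sample amplification from `n` to `n + m` samples. -/
def minimaxError {X : Type*} [MeasurableSpace X] (𝓟 : Set (ProbabilityMeasure X)) (n m : ℕ) :
    ℝ≥0∞ :=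
  ⨅ (T : Kernel (Fin n → X) (Fin (n + m) → X)) (_ : IsMarkovKernel T), amplificationError 𝓟 T

/-- The normal distribution `N(θ, S)` on `ℝ^d`. -/
def normal {d : ℕ} (θ : EuclideanSpace ℝ (Fin d)) (S : Matrix (Fin d) (Fin d) ℝ) :
    ProbabilityMeasure (EuclideanSpace ℝ (Fin d)) :=
  ⟨multivariateGaussian θ S, inferInstance⟩

/-- The Gaussian location model `{N(θ, S) : θ ∈ ℝ^d}`. -/
def gaussianLocation {d : ℕ} (S : Matrix (Fin d) (Fin d) ℝ) :
    Set (ProbabilityMeasure (EuclideanSpace ℝ (Fin d))) :=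
  Set.range fun θ => normal θ S

/-- The sample mean of `k` observations. -/
def sampleMean {d : ℕ} (k : ℕ) (x : Fin k → EuclideanSpace ℝ (Fin d)) :
    EuclideanSpace ℝ (Fin d) :=
  (k : ℝ)⁻¹ • ∑ i, x i

lemma measurable_sampleMean {d : ℕ} (k : ℕ) : Measurable (sampleMean (d := d) k) := by
  unfold sampleMean
  fun_prop

/-- `K` is a regular conditional distribution of `ω` given `T ω` under `P`:
the joint law of `(T ω, ω)` disintegrates as the law of `T ω` followed by `K`. -/
def IsCondLawGiven {Ω 𝓣 : Type*} [MeasurableSpace Ω] [MeasurableSpace 𝓣] (P : Measure Ω)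
    (T : Ω → 𝓣) (K : Kernel 𝓣 Ω) : Prop :=
  P.map (fun ω => (T ω, ω)) = (P.map T) ⊗ₘ K

/-- The sufficiency-based procedure: compute the mean `t` of the `n` input samples, and output
`n + m` samples drawn from `K t`, where `K` is the conditional distribution of `n + m`
samples given their mean. -/
def sufficiencyProcedure {d n m : ℕ}
    (K : Kernel (EuclideanSpace ℝ (Fin d)) (Fin (n + m) → EuclideanSpace ℝ (Fin d))) :
    Kernel (Fin n → EuclideanSpace ℝ (Fin d)) (Fin (n + m) → EuclideanSpace ℝ (Fin d)) :=
  K.comap (sampleMean n) (measurable_sampleMean n)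

instance {d n m : ℕ}
    (K : Kernel (EuclideanSpace ℝ (Fin d)) (Fin (n + m) → EuclideanSpace ℝ (Fin d)))
    [IsMarkovKernel K] : IsMarkovKernel (sufficiencyProcedure (n := n) K) := by
  unfold sufficiencyProcedure
  infer_instance

end SampleAmplification

end

/-! The sample mean is sufficient, so the problem lives on means. Whitened by `S^{1/2}`, the means
of `n` and `n + m` samples have laws `N(u, a²I)` and `N(u, b²I)`, with `a = 1/√n ≥ b = 1/√(n+m)`.

Upper bound: the conditional kernel given the mean sends the law of the mean of `n + m` samples
exactly to the i.i.d. law. Data processing then bounds the error by the distance between the laws of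
the two means (`amplificationError_sufficiencyProcedure_le`). Independence of mean and residuals
makes this kernel free of `θ`.

Lower bound: a procedure with error `ε` induces a Markov kernel on means taking `N(u, a²I)` to
within `ε` of `N(u, b²I)` for every `u` (`le_amplificationError`). Test this only on balls centered
at `u`, and average over a Gaussian prior on `u`. Given the observation, `u` is Gaussian with
isotropic variance below `a²`, so no guess lands within `r` of `u` more often than the posterior
mean does (`bayes_ball_le`). As the prior flattens, the posterior variance tends to `a²`, whence
`N(0, b²I)(ball) ≤ N(0, a²I)(ball) + ε`. The two radial densities cross at a single radius, so some
centered ball attains the total variation distance, and the bounds meet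
(`tvDist_le_of_forall_ball_le`). -/

namespace SampleAmplification

/-! ### Total variation distance and data processing -/

section TotalVariation

variable {Ω Ω' : Type*} [MeasurableSpace Ω] [MeasurableSpace Ω']

/-- The Jordan decomposition of `P - Q` for probability measures, with both parts of mass
`tvDist P Q`. -/
lemma exists_jordan_tvDist (P Q : Measure Ω) [IsProbabilityMeasure P] [IsProbabilityMeasure Q] :
    ∃ μ ν : Measure Ω, IsFiniteMeasure μ ∧ P + ν = Q + μ ∧ μ ⟂ₘ ν ∧ tvDist P Q = μ Set.univ := by
  set s := P.toSignedMeasure - Q.toSignedMeasure with hs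
  set j := s.toJordanDecomposition
  have hj : j.posPart.toSignedMeasure - j.negPart.toSignedMeasure = s :=
    s.toSignedMeasure_toJordanDecomposition
  have hadd : P + j.negPart = Q + j.posPart := by
    rw [hs, sub_eq_sub_iff_add_eq_add] at hj
    rw [← Measure.toSignedMeasure_eq_toSignedMeasure_iff, Measure.toSignedMeasure_add,
      Measure.toSignedMeasure_add, add_comm, add_comm Q.toSignedMeasure, hj, add_comm]
  -- `P` and `Q` have equal mass, hence so do the two Jordan parts; halving the total variation
  -- leaves the mass of one of them.
  have huniv : j.negPart Set.univ = j.posPart Set.univ := by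
    have := congrArg (fun μ => μ Set.univ) hadd
    simpa using this
  refine ⟨j.posPart, j.negPart, inferInstance, hadd, j.mutuallySingular, ?_⟩
  change (j.posPart + j.negPart) Set.univ / 2 = _
  rw [Measure.add_apply, huniv, ← two_mul, mul_comm,
    ENNReal.mul_div_cancel_right two_ne_zero ENNReal.ofNat_ne_top]

/-- The excess of `P B` over `Q B` is at most the mass of the positive Jordan part, with equality on
a set carrying that part and null for the negative part. Lower bounds can thus be tested on single
events. -/
lemma tvDist_le_iff {P Q : Measure Ω} [IsProbabilityMeasure P] [IsProbabilityMeasure Q]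
    {ε : ℝ≥0∞} : tvDist P Q ≤ ε ↔ ∀ B, MeasurableSet B → P B ≤ Q B + ε := by
  obtain ⟨μ, ν, _, hadd, ⟨A, hA, hμA, hνA⟩, htv⟩ := exists_jordan_tvDist P Q
  rw [htv]
  refine ⟨fun h B _ => ?_, fun h => ?_⟩
  · calc P B ≤ (P + ν) B := by simp
      _ = Q B + μ B := by rw [hadd, Measure.add_apply]
      _ ≤ Q B + ε := by gcongr; exact (measure_mono (Set.subset_univ B)).trans h
  · have h1 : P Aᶜ = Q Aᶜ + μ Set.univ := by
      have := congrArg (fun μ => μ Aᶜ) hadd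
      simpa [hνA, ← measure_add_measure_compl hA, hμA] using this
    have h2 := h Aᶜ hA.compl
    rw [h1] at h2
    exact (ENNReal.add_le_add_iff_left (measure_ne_top Q _)).1 h2

lemma tvDist_comm (P Q : Measure Ω) [IsFiniteMeasure P] [IsFiniteMeasure Q] :
    tvDist P Q = tvDist Q P := by
  rw [tvDist, ← neg_sub, SignedMeasure.totalVariation_neg, tvDist]

/-- Data processing: a Markov kernel does not increase the total variation distance. -/
lemma tvDist_comp_le (κ : Kernel Ω Ω') [IsMarkovKernel κ] (P Q : Measure Ω)
    [IsProbabilityMeasure P] [IsProbabilityMeasure Q] :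
    tvDist (κ ∘ₘ P) (κ ∘ₘ Q) ≤ tvDist P Q := by
  obtain ⟨μ, ν, _, hadd, -, htv⟩ := exists_jordan_tvDist P Q
  refine tvDist_le_iff.2 fun B hB => ?_
  calc (κ ∘ₘ P) B ≤ (κ ∘ₘ P) B + (κ ∘ₘ ν) B := le_self_add
    _ = (κ ∘ₘ (P + ν)) B := by
      simp only [Measure.bind_apply hB κ.measurable.aemeasurable, lintegral_add_measure]
    _ = (κ ∘ₘ Q) B + (κ ∘ₘ μ) B := by
      rw [hadd]
      simp only [Measure.bind_apply hB κ.measurable.aemeasurable, lintegral_add_measure]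
    _ ≤ (κ ∘ₘ Q) B + tvDist P Q := by
      gcongr
      rw [htv, ← Measure.comp_apply_univ (μ := μ) (κ := κ)]
      exact measure_mono (Set.subset_univ B)

lemma tvDist_map_le {f : Ω → Ω'} (hf : Measurable f) (P Q : Measure Ω)
    [IsProbabilityMeasure P] [IsProbabilityMeasure Q] :
    tvDist (P.map f) (Q.map f) ≤ tvDist P Q := by
  have := tvDist_comp_le (Kernel.deterministic f hf) P Q
  simpa only [Measure.deterministic_comp_eq_map hf] using this

end TotalVariation

/-! ### Isotropic Gaussian densities and balls -/

section GaussianDensity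

open scoped RealInnerProductSpace

variable {E : Type*} [NormedAddCommGroup E] [InnerProductSpace ℝ E]

variable (E) in
/-- The density of `s • Z`, for `Z` standard Gaussian on `E`, at a point of norm `t`. -/
noncomputable def radialDensity (s t : ℝ) : ℝ :=
  ((2 * s ^ 2)⁻¹ / Real.pi) ^ ((Module.finrank ℝ E : ℝ) / 2) * Real.exp (-(2 * s ^ 2)⁻¹ * t ^ 2)

lemma radialDensity_nonneg (s t : ℝ) : 0 ≤ radialDensity E s t := by
  unfold radialDensity; positivity

lemma radialDensity_anti (s : ℝ) {t t' : ℝ} (h0 : 0 ≤ t) (h : t ≤ t') :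
    radialDensity E s t' ≤ radialDensity E s t := by
  unfold radialDensity
  simp only [neg_mul]
  gcongr

/-- Two centered isotropic Gaussian densities cross at one radius. -/
lemma exists_radialDensity_crossing {a b : ℝ} (hb : 0 < b) (hab : b ≤ a) :
    ∃ r, 0 ≤ r ∧ (∀ t, 0 ≤ t → t ≤ r → radialDensity E a t ≤ radialDensity E b t) ∧
      ∀ t, r ≤ t → radialDensity E b t ≤ radialDensity E a t := by
  rcases hab.eq_or_lt with rfl | hab
  · exact ⟨0, le_rfl, fun _ _ _ => le_rfl, fun _ _ => le_rfl⟩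
  set p : ℝ := (2 * a ^ 2)⁻¹ with hp
  set q : ℝ := (2 * b ^ 2)⁻¹ with hq
  have hp0 : 0 < p := by have := hb.trans hab; positivity
  have hpq : p < q := by rw [hp, hq]; gcongr
  have hq0 := hp0.trans hpq
  set k : ℝ := (Module.finrank ℝ E : ℝ) / 2
  have hk : 0 ≤ k := by positivity
  set A : ℝ := (p / Real.pi) ^ k
  set B : ℝ := (q / Real.pi) ^ k
  have hA : 0 < A := by positivity
  have hB : 0 < B := by positivity
  have hAB : A ≤ B := by
    have := Real.pi_pos
    exact Real.rpow_le_rpow (by positivity) (by gcongr) hk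
  have hl : 0 ≤ (Real.log B - Real.log A) / (q - p) :=
    div_nonneg (sub_nonneg.2 (Real.log_le_log hA hAB)) (sub_pos.2 hpq).le
  have key : ∀ C c t : ℝ, 0 < C → C * Real.exp (-c * t ^ 2) = Real.exp (Real.log C - c * t ^ 2) := by
    intro C c t hC
    rw [sub_eq_add_neg, Real.exp_add, Real.exp_log hC, neg_mul]
  -- The log-densities `log A - p t²` and `log B - q t²` agree where `t² = (log B - log A) / (q -
  -- p)`.
  refine ⟨√((Real.log B - Real.log A) / (q - p)), Real.sqrt_nonneg _, fun t ht htr => ?_,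
    fun t htr => ?_⟩
  · rw [Real.le_sqrt ht hl, le_div_iff₀ (sub_pos.2 hpq)] at htr
    change A * _ ≤ B * _
    rw [key _ _ _ hA, key _ _ _ hB]
    exact Real.exp_le_exp.2 (by linarith)
  · have ht : 0 ≤ t := (Real.sqrt_nonneg _).trans htr
    rw [Real.sqrt_le_left ht, div_le_iff₀ (sub_pos.2 hpq)] at htr
    change B * _ ≤ A * _
    rw [key _ _ _ hA, key _ _ _ hB]
    exact Real.exp_le_exp.2 (by linarith)

variable [FiniteDimensional ℝ E] [MeasurableSpace E] [BorelSpace E]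

lemma integrable_radialDensity {s : ℝ} (hs : s ≠ 0) :
    Integrable (fun x : E => radialDensity E s ‖x‖) := by
  unfold radialDensity
  refine Integrable.const_mul ?_ _
  have hq : 0 < (((2 * s ^ 2)⁻¹ : ℝ) : ℂ).re := by rw [Complex.ofReal_re]; positivity
  have h := GaussianFourier.integrable_cexp_neg_mul_sq_norm_add hq 0 (0 : E)
  convert h.re using 2 with x
  simp only [zero_mul, add_zero, RCLike.re_eq_complex_re]
  rw [← Complex.ofReal_neg, ← Complex.ofReal_pow, ← Complex.ofReal_mul, Complex.exp_ofReal_re]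

lemma charFun_stdGaussian_map_smul (s : ℝ) (t : E) :
    charFun ((stdGaussian E).map fun x => s • x) t = Complex.exp (-(s ^ 2 * ‖t‖ ^ 2) / 2) := by
  rw [charFun_map_smul, charFun_stdGaussian, norm_smul, Complex.ofReal_mul, mul_pow]
  congr 3
  rw [← Complex.ofReal_pow, Real.norm_eq_abs, sq_abs, Complex.ofReal_pow]

/-- The law of `s • Z`, for `Z` standard Gaussian, has an explicit radial density. -/
lemma stdGaussian_map_smul_eq_withDensity {s : ℝ} (hs : s ≠ 0) :
    (stdGaussian E).map (fun x => s • x) =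
      volume.withDensity fun x => ENNReal.ofReal (radialDensity E s ‖x‖) := by
  have : IsFiniteMeasure (volume.withDensity
      fun x : E => ENNReal.ofReal (radialDensity E s ‖x‖)) :=
    isFiniteMeasure_withDensity_ofReal (integrable_radialDensity hs).2
  refine Measure.ext_of_charFun (funext fun t => ?_)
  have hq : 0 < (((2 * s ^ 2)⁻¹ : ℝ) : ℂ).re := by rw [Complex.ofReal_re]; positivity
  have hqpos : (0 : ℝ) < (2 * s ^ 2)⁻¹ := by positivity
  have hint := GaussianFourier.integral_cexp_neg_mul_sq_norm_add hq Complex.I t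
  rw [charFun_stdGaussian_map_smul, charFun_apply,
    integral_withDensity_eq_integral_toReal_smul (by unfold radialDensity; fun_prop)
      (Filter.Eventually.of_forall fun _ => ENNReal.ofReal_lt_top)]
  have hfun : ∀ x : E, (ENNReal.ofReal (radialDensity E s ‖x‖)).toReal •
      Complex.exp (⟪x, t⟫ * Complex.I) =
      (((2 * s ^ 2)⁻¹ / Real.pi : ℝ) ^ ((Module.finrank ℝ E : ℝ) / 2) : ℝ) *
        Complex.exp (-((2 * s ^ 2)⁻¹ : ℝ) * ‖x‖ ^ 2 + Complex.I * ⟪t, x⟫) := by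
    intro x
    rw [ENNReal.toReal_ofReal (radialDensity_nonneg _ _), radialDensity, Complex.real_smul,
      Complex.ofReal_mul, mul_assoc, Complex.ofReal_exp, ← Complex.exp_add, real_inner_comm x t,
      mul_comm Complex.I]
    push_cast
    rfl
  simp_rw [hfun]
  rw [integral_const_mul, hint, ← mul_assoc]
  -- The normalizing constant cancels the Gaussian integral, leaving the characteristic function.
  have hone : (((((2 * s ^ 2)⁻¹ / Real.pi : ℝ) ^ ((Module.finrank ℝ E : ℝ) / 2) : ℝ)) : ℂ) *
      (Real.pi / ((2 * s ^ 2)⁻¹ : ℝ) : ℂ) ^ ((Module.finrank ℝ E : ℂ) / 2) = 1 := by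
    rw [← Complex.ofReal_div, show ((Module.finrank ℝ E : ℂ) / 2) =
      (((Module.finrank ℝ E : ℝ) / 2 : ℝ) : ℂ) by push_cast; rfl,
      ← Complex.ofReal_cpow (by positivity), ← Complex.ofReal_mul,
      ← Real.mul_rpow (by positivity) (by positivity)]
    rw [div_mul_div_comm, mul_comm Real.pi, div_self (by positivity), Real.one_rpow,
      Complex.ofReal_one]
  rw [hone, one_mul, Complex.I_sq]
  congr 1
  have hs' : (s : ℂ) ≠ 0 := by exact_mod_cast hs
  push_cast
  field_simp
  norm_num

/-- The two balls have equal volume, hence so do their set differences. The density is radially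
decreasing: at most its value at radius `r` outside the centered ball, and at least that value
inside. -/
lemma stdGaussian_map_smul_ball_le {s : ℝ} (hs : s ≠ 0) (y : E) (r : ℝ) :
    ((stdGaussian E).map fun x => s • x) (Metric.closedBall y r) ≤
      ((stdGaussian E).map fun x => s • x) (Metric.closedBall 0 r) := by
  rcases lt_or_ge r 0 with hr | hr
  · simp [Metric.closedBall_eq_empty.2 hr]
  rw [stdGaussian_map_smul_eq_withDensity hs]
  set g : E → ℝ≥0∞ := fun x => ENNReal.ofReal (radialDensity E s ‖x‖)
  set B := Metric.closedBall y r
  set C := Metric.closedBall (0 : E) r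
  have hB : MeasurableSet B := Metric.isClosed_closedBall.measurableSet
  have hC : MeasurableSet C := Metric.isClosed_closedBall.measurableSet
  have hvol : volume (B \ C) = volume (C \ B) := by
    have h1 := measure_inter_add_sdiff (μ := volume) B hC
    have h2 := measure_inter_add_sdiff (μ := volume) C hB
    rw [Measure.addHaar_closedBall_center volume y r, ← h2, Set.inter_comm] at h1
    exact (ENNReal.add_right_inj (measure_ne_top_of_subset Set.inter_subset_left
      (by simpa [C] using measure_closedBall_lt_top.ne))).1 h1
  rw [← measure_inter_add_sdiff B hC, ← measure_inter_add_sdiff C hB, Set.inter_comm]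
  gcongr 1
  set c := ENNReal.ofReal (radialDensity E s r)
  rw [withDensity_apply _ (hB.diff hC), withDensity_apply _ (hC.diff hB)]
  calc ∫⁻ x in B \ C, g x ≤ ∫⁻ _ in B \ C, c := by
        refine setLIntegral_mono' (hB.diff hC) fun x hx => ENNReal.ofReal_le_ofReal ?_
        have : ¬ ‖x‖ ≤ r := by simpa [C] using hx.2
        exact radialDensity_anti s hr (not_le.1 this).le
    _ = ∫⁻ _ in C \ B, c := by simp [hvol]
    _ ≤ ∫⁻ x in C \ B, g x := by
        refine setLIntegral_mono' (hC.diff hB) fun x hx => ENNReal.ofReal_le_ofReal ?_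
        have : ‖x‖ ≤ r := by simpa [C] using hx.1
        exact radialDensity_anti s (norm_nonneg x) this

/-- Between two centered isotropic Gaussian laws the difference is maximized by a ball. -/
lemma exists_ball_maximizing {a b : ℝ} (hb : 0 < b) (hab : b ≤ a) :
    ∃ r : ℝ, ∀ B : Set E, MeasurableSet B →
      ((stdGaussian E).map fun x => b • x) B +
          ((stdGaussian E).map fun x => a • x) (Metric.closedBall 0 r) ≤
        ((stdGaussian E).map fun x => a • x) B +
          ((stdGaussian E).map fun x => b • x) (Metric.closedBall 0 r) := by
  obtain ⟨r, hr, h1, h2⟩ := exists_radialDensity_crossing (E := E) hb hab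
  refine ⟨r, fun B hB => ?_⟩
  rw [stdGaussian_map_smul_eq_withDensity hb.ne',
    stdGaussian_map_smul_eq_withDensity (hb.trans_le hab).ne']
  set μ := volume.withDensity fun x : E => ENNReal.ofReal (radialDensity E a ‖x‖)
  set ν := volume.withDensity fun x : E => ENNReal.ofReal (radialDensity E b ‖x‖)
  set C := Metric.closedBall (0 : E) r
  have hC : MeasurableSet C := Metric.isClosed_closedBall.measurableSet
  have i1 : ν (B \ C) ≤ μ (B \ C) := by
    rw [withDensity_apply _ (hB.diff hC), withDensity_apply _ (hB.diff hC)]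
    refine setLIntegral_mono' (hB.diff hC) fun x hx => ENNReal.ofReal_le_ofReal ?_
    have : ¬ ‖x‖ ≤ r := by simpa [C] using hx.2
    exact h2 _ (not_le.1 this).le
  have i2 : μ (C \ B) ≤ ν (C \ B) := by
    rw [withDensity_apply _ (hC.diff hB), withDensity_apply _ (hC.diff hB)]
    refine setLIntegral_mono' (hC.diff hB) fun x hx => ENNReal.ofReal_le_ofReal ?_
    have : ‖x‖ ≤ r := by simpa [C] using hx.1
    exact h1 _ (norm_nonneg x) this
  rw [← measure_inter_add_sdiff (μ := ν) B hC, ← measure_inter_add_sdiff (μ := μ) B hC,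
    ← measure_inter_add_sdiff (μ := ν) C hB, ← measure_inter_add_sdiff (μ := μ) C hB,
    Set.inter_comm C B]
  calc _ ≤ ν (B ∩ C) + μ (B \ C) + (μ (B ∩ C) + ν (C \ B)) := by gcongr
    _ = _ := by ring

end GaussianDensity

/-! ### Sample mean and residuals of Gaussian samples -/

section SampleMean

variable {d : ℕ}

lemma sampleMean_add (k : ℕ) (x y : Fin k → EuclideanSpace ℝ (Fin d)) :
    sampleMean k (x + y) = sampleMean k x + sampleMean k y := by
  simp only [sampleMean, Pi.add_apply, Finset.sum_add_distrib, smul_add]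

lemma sampleMean_smul (k : ℕ) (c : ℝ) (x : Fin k → EuclideanSpace ℝ (Fin d)) :
    sampleMean k (c • x) = c • sampleMean k x := by
  simp only [sampleMean, Pi.smul_apply, ← Finset.smul_sum, smul_comm c]

lemma covariance_eval_pi {E ι : Type*} [NormedAddCommGroup E] [NormedSpace ℝ E]
    [MeasurableSpace E] [BorelSpace E] [SecondCountableTopology E] [CompleteSpace E]
    [Fintype ι] [DecidableEq ι] (μ : Measure E) [IsGaussian μ]
    (L M : StrongDual ℝ E) (i j : ι) :
    cov[fun z : ι → E => L (z i), fun z => M (z j); Measure.pi fun _ => μ] =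
      if i = j then cov[L, M; μ] else 0 := by
  have hmem (L : StrongDual ℝ E) (i : ι) :
      MemLp (fun z : ι → E => L (z i)) 2 (Measure.pi fun _ => μ) :=
    (IsGaussian.memLp_dual μ L 2 (by simp)).comp_measurePreserving
      (measurePreserving_eval (fun _ : ι => μ) i)
  split_ifs with h
  · subst h
    have hm := measurePreserving_eval (fun _ : ι => μ) i
    conv_rhs => rw [← hm.map_eq]
    rw [covariance_map (by fun_prop) (by fun_prop)
      hm.measurable.aemeasurable]
    rfl
  · have hind := (iIndepFun_pi (μ := fun _ : ι => μ) (X := fun _ => id)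
      fun _ => aemeasurable_id).indepFun h
    exact (hind.comp L.measurable M.measurable).covariance_eq_zero (hmem L i) (hmem M j)

/-- The sample mean of Gaussian vectors is independent of the residuals. -/
lemma indepFun_sampleMean_residual (μ : Measure (EuclideanSpace ℝ (Fin d))) [IsGaussian μ] {k : ℕ}
    (hk : 0 < k) :
    IndepFun (sampleMean k) (fun z i => z i - sampleMean k z) (Measure.pi fun _ : Fin k => μ) := by
  set E := EuclideanSpace ℝ (Fin d)
  -- Mean and residuals are a linear image of the sample, hence jointly Gaussian; independence
  -- reduces to vanishing covariances.
  let Φ : (Fin k → E) →ₗ[ℝ] E × (Fin k → E) :=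
    { toFun := fun z => (sampleMean k z, fun i => z i - sampleMean k z)
      map_add' := fun x y => by
        ext1
        · exact sampleMean_add k x y
        · funext i
          simp only [sampleMean_add, Pi.add_apply, Prod.mk_add_mk]
          abel
      map_smul' := fun c x => by
        ext1
        · exact sampleMean_smul k c x
        · funext i
          simp only [sampleMean_smul, Pi.smul_apply, Prod.smul_mk, RingHom.id_apply, smul_sub] }
  have hgauss : HasGaussianLaw (fun z : Fin k → E => (sampleMean k z, fun i => z i - sampleMean k z))
      (Measure.pi fun _ : Fin k => μ) := by
    have h := (iIndepFun_pi (μ := fun _ : Fin k => μ) (X := fun _ => id)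
      fun _ => aemeasurable_id).hasGaussianLaw fun i =>
        ⟨by
          have : (Measure.pi fun _ : Fin k => μ).map (fun z => z i) = μ :=
            (measurePreserving_eval (fun _ : Fin k => μ) i).map_eq
          simp only [id_eq]
          rw [this]
          infer_instance⟩
    exact h.map_fun Φ.toContinuousLinearMap
  refine hgauss.indepFun_of_covariance_strongDual fun L₁ L₂ => ?_
  have hmem (L : StrongDual ℝ E) (i : Fin k) :
      MemLp (fun z : Fin k → E => L (z i)) 2 (Measure.pi fun _ => μ) :=
    (IsGaussian.memLp_dual μ L 2 (by simp)).comp_measurePreserving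
      (measurePreserving_eval (fun _ : Fin k => μ) i)
  let M : Fin k → StrongDual ℝ E := fun j =>
    L₂.comp (ContinuousLinearMap.single ℝ (fun _ : Fin k => E) j)
  have h1 : L₁ ∘ sampleMean k = fun z : Fin k → E => (k : ℝ)⁻¹ * ∑ i, L₁ (z i) := by
    ext z; simp [sampleMean]
  have h2 : (L₂ ∘ fun (z : Fin k → E) i => z i - sampleMean k z) =
      fun z => ∑ j, (M j (z j) - (k : ℝ)⁻¹ * ∑ l, M j (z l)) := by
    ext z
    rw [Function.comp_apply, ← ContinuousLinearMap.sum_comp_single ℝ (fun _ : Fin k => E) L₂]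
    refine Finset.sum_congr rfl fun j _ => ?_
    change M j _ = _
    simp [sampleMean]
  have hmem2 (L : StrongDual ℝ E) :
      MemLp (fun z : Fin k → E => (k : ℝ)⁻¹ * ∑ l, L (z l)) 2 (Measure.pi fun _ => μ) :=
    (memLp_finsetSum _ fun l _ => hmem L l).const_mul _
  rw [h1, h2, covariance_const_mul_left, covariance_fun_sum_fun_sum (hmem L₁)
    (Y := fun j z => M j (z j) - (k : ℝ)⁻¹ * ∑ l, M j (z l))
    fun j => (hmem (M j) j).sub (hmem2 (M j))]
  have h3 (i j : Fin k) : cov[fun z : Fin k → E => L₁ (z i),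
      fun z => M j (z j) - (k : ℝ)⁻¹ * ∑ l, M j (z l); Measure.pi fun _ => μ] =
      (if i = j then cov[L₁, M j; μ] else 0) - (k : ℝ)⁻¹ * cov[L₁, M j; μ] := by
    rw [covariance_fun_sub_right (hmem L₁ i) (hmem (M j) j) (hmem2 (M j)), covariance_eval_pi,
      covariance_const_mul_right, covariance_fun_sum_right (hmem (M j)) (hmem L₁ i)]
    simp [covariance_eval_pi]
  have hk' : (k : ℝ) ≠ 0 := by exact_mod_cast hk.ne'
  -- For each `j`, summing `h3` over `i` gives one covariance minus `k` copies of its `k`-th part.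
  simp [h3, Finset.sum_sub_distrib, ← Finset.mul_sum, hk']

/-- The law of the sample mean of standard Gaussian vectors. -/
lemma map_sampleMean_stdGaussian {k : ℕ} (hk : 0 < k) :
    (Measure.pi fun _ : Fin k => stdGaussian (EuclideanSpace ℝ (Fin d))).map (sampleMean k) =
      (stdGaussian (EuclideanSpace ℝ (Fin d))).map fun x => (√k)⁻¹ • x := by
  have hk' : (k : ℂ) ≠ 0 := by exact_mod_cast hk.ne'
  have hfun : sampleMean (d := d) k = (fun x => (k : ℝ)⁻¹ • x) ∘ fun z => ∑ i, z i := rfl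
  have hm := measurable_sampleMean (d := d) k
  have : IsProbabilityMeasure ((Measure.pi fun _ : Fin k =>
      stdGaussian (EuclideanSpace ℝ (Fin d))).map (sampleMean k)) :=
    Measure.isProbabilityMeasure_map hm.aemeasurable
  refine Measure.ext_of_charFun (funext fun t => ?_)
  rw [charFun_stdGaussian_map_smul, hfun, ← Measure.map_map (by fun_prop) (by fun_prop),
    charFun_map_smul, charFun_map_sum_pi_eq_prod, Finset.prod_apply]
  simp only [charFun_stdGaussian, Finset.prod_const, Finset.card_univ, Fintype.card_fin]
  rw [← Complex.exp_nat_mul]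
  congr 1
  rw [← Complex.ofReal_pow (√k)⁻¹, inv_pow, Real.sq_sqrt (Nat.cast_nonneg k), norm_smul]
  push_cast
  rw [Real.norm_of_nonneg (by positivity)]
  push_cast
  field_simp

/-- The joint law of the sample mean and the sample is that of an independent copy of the mean
together with the sample recentered at that copy. -/
lemma map_sampleMean_prodMk (μ : Measure (EuclideanSpace ℝ (Fin d))) [IsGaussian μ] {k : ℕ}
    (hk : 0 < k) :
    (Measure.pi fun _ : Fin k => μ).map (fun z => (sampleMean k z, z)) =
      (((Measure.pi fun _ : Fin k => μ).map (sampleMean k)).prod (Measure.pi fun _ : Fin k => μ)).map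
        fun p => (p.1, fun i => p.1 + (p.2 i - sampleMean k p.2)) := by
  have hm := measurable_sampleMean (d := d) k
  have hind := (indepFun_iff_map_prod_eq_prod_map_map hm.aemeasurable
    (by fun_prop)).1 (indepFun_sampleMean_residual μ hk)
  have hR : Measurable fun (z : Fin k → EuclideanSpace ℝ (Fin d)) i => z i - sampleMean k z := by
    fun_prop
  have hG : Measurable fun p : EuclideanSpace ℝ (Fin d) × (Fin k → EuclideanSpace ℝ (Fin d)) =>
      (p.1, fun i => p.1 + p.2 i) := by fun_prop
  have h := congrArg (Measure.map fun p => (p.1, fun i => p.1 + p.2 i)) hind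
  rw [Measure.map_map hG (hm.prodMk hR)] at h
  have h1 : (fun p : EuclideanSpace ℝ (Fin d) × (Fin k → EuclideanSpace ℝ (Fin d)) =>
      (p.1, fun i => p.1 + p.2 i)) ∘
      (fun z => (sampleMean k z, fun i => z i - sampleMean k z)) = fun z => (sampleMean k z, z) := by
    ext z <;> simp
  rw [h1] at h
  rw [h]
  have : SFinite ((Measure.pi fun _ : Fin k => μ).map (sampleMean k)) := inferInstance
  nth_rewrite 1 [← Measure.map_id (μ := (Measure.pi fun _ : Fin k => μ).map (sampleMean k))]
  rw [Measure.map_prod_map _ _ measurable_id hR, Measure.map_map hG (by fun_prop)]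
  rfl

end SampleMean

/-! ### Bayes bound for hitting a ball around the location -/

section BayesRisk

variable {E : Type*} [NormedAddCommGroup E] [InnerProductSpace ℝ E] [FiniteDimensional ℝ E]
  [MeasurableSpace E] [BorelSpace E]

instance isProbabilityMeasure_stdGaussian_map_smul (s : ℝ) :
    IsProbabilityMeasure ((stdGaussian E).map fun x => s • x) :=
  Measure.isProbabilityMeasure_map (by fun_prop)

instance isProbabilityMeasure_stdGaussian_map_add_smul (u : E) (s : ℝ) :
    IsProbabilityMeasure ((stdGaussian E).map fun x => u + s • x) :=
  Measure.isProbabilityMeasure_map (by fun_prop)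

/-- Here `c - s • w` is the location under its posterior and `κ` the law of an independent guess. By
Fubini the guess can be fixed at `y`; it succeeds when `s • w` falls in a ball centered at `c - y`,
and the centered ball is the best case. -/
lemma lintegral_ball_sub_smul_le (κ : Measure E) [IsProbabilityMeasure κ] {s : ℝ} (hs : s ≠ 0)
    (c : E) (r : ℝ) :
    ∫⁻ w, κ (Metric.closedBall (c - s • w) r) ∂(stdGaussian E) ≤
      ((stdGaussian E).map fun x => s • x) (Metric.closedBall 0 r) := by
  set A : Set (E × E) := {p | dist p.2 (c - s • p.1) ≤ r} with hA
  have hAm : MeasurableSet A := measurableSet_le (by fun_prop) measurable_const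
  have h1 := (Measure.prod_apply (μ := stdGaussian E) (ν := κ) hAm).symm
  rw [Measure.prod_apply_symm hAm] at h1
  change ∫⁻ w, κ (Prod.mk w ⁻¹' A) ∂(stdGaussian E) ≤ _
  rw [h1]
  calc ∫⁻ y, (stdGaussian E) ((fun x => (x, y)) ⁻¹' A) ∂κ
      = ∫⁻ y, ((stdGaussian E).map fun x => s • x) (Metric.closedBall (c - y) r) ∂κ := by
        refine lintegral_congr fun y => ?_
        rw [Measure.map_apply (by fun_prop) Metric.isClosed_closedBall.measurableSet]
        congr 1
        ext w
        simp only [hA, Set.mem_preimage, Set.mem_ofPred_eq, Metric.mem_closedBall, dist_eq_norm]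
        rw [show s • w - (c - y) = y - (c - s • w) by abel]
    _ ≤ ∫⁻ _, ((stdGaussian E).map fun x => s • x) (Metric.closedBall 0 r) ∂κ :=
        lintegral_mono fun y => stdGaussian_map_smul_ball_le hs _ _
    _ = _ := by simp

/-- Under a Gaussian prior on the location, no randomized estimator hits the ball around the true
location with larger probability than the posterior mean does. -/
lemma bayes_ball_le (T : Kernel E E) [IsMarkovKernel T] {a θ : ℝ} (ha : 0 < a)
    (hcos : 0 < Real.cos θ) (hsin : 0 < Real.sin θ) (r : ℝ) :
    ∫⁻ z, (T ∘ₘ (stdGaussian E).map fun x => (a * Real.cos θ / Real.sin θ) • z + a • x)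
        (Metric.closedBall ((a * Real.cos θ / Real.sin θ) • z) r) ∂(stdGaussian E) ≤
      ((stdGaussian E).map fun x => (a * Real.cos θ) • x) (Metric.closedBall 0 r) := by
  -- With prior scale `τ = a cot θ`, the observation `τ z + a x` is `(a / sin θ) w`, where `w = cos
  -- θ z + sin θ x`. The rotated coordinate `v` is independent of `w`, and the location is `τ cos θ
  -- w - a cos θ v`: the posterior has scale `a cos θ`.
  set τ := a * Real.cos θ / Real.sin θ with hτ
  set γ := stdGaussian E
  set F : E × E → ℝ≥0∞ := fun p => T (τ • p.1 + a • p.2) (Metric.closedBall (τ • p.1) r) with hF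
  have hFm : Measurable F := by
    have hAm : MeasurableSet {p : (E × E) × E | dist p.2 (τ • p.1.1) ≤ r} :=
      measurableSet_le (by fun_prop) measurable_const
    have hg : Measurable fun p : E × E => τ • p.1 + a • p.2 := by fun_prop
    exact Kernel.measurable_kernel_prodMk_left (κ := T.comap _ hg) hAm
  have hrot := IsGaussian.map_rotation_eq_self (μ := γ) integral_id_stdGaussian (-θ)
  calc ∫⁻ z, (T ∘ₘ γ.map fun x => τ • z + a • x) (Metric.closedBall (τ • z) r) ∂γ
      = ∫⁻ z, ∫⁻ x, F (z, x) ∂γ ∂γ := by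
        refine lintegral_congr fun z => ?_
        have hB : MeasurableSet (Metric.closedBall (τ • z) r) :=
          Metric.isClosed_closedBall.measurableSet
        rw [Measure.bind_apply hB T.measurable.aemeasurable,
          lintegral_map (T.measurable_coe hB) (by fun_prop)]
    _ = ∫⁻ p, F p ∂(γ.prod γ) := (lintegral_prod _ hFm.aemeasurable).symm
    _ = ∫⁻ p, F (ContinuousLinearMap.rotation (-θ) p) ∂(γ.prod γ) := by
        conv_lhs => rw [← hrot]
        rw [lintegral_map hFm (by fun_prop)]
    _ = ∫⁻ w, ∫⁻ v, F (ContinuousLinearMap.rotation (-θ) (w, v)) ∂γ ∂γ :=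
        lintegral_prod _ (hFm.comp (by fun_prop)).aemeasurable
    _ ≤ ∫⁻ _, (γ.map fun x => (a * Real.cos θ) • x) (Metric.closedBall 0 r) ∂γ := by
        refine lintegral_mono fun w => ?_
        have hs : a * Real.cos θ ≠ 0 := by positivity
        refine le_trans (le_of_eq (lintegral_congr fun v => ?_)) (lintegral_ball_sub_smul_le
          (T ((a / Real.sin θ) • w)) hs ((τ * Real.cos θ) • w) r)
        have h1 : τ * -Real.sin θ = -(a * Real.cos θ) := by rw [hτ]; field_simp
        have h2 : τ * Real.cos θ + a * Real.sin θ = a / Real.sin θ := by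
          rw [hτ]; field_simp; linear_combination Real.cos_sq_add_sin_sq θ
        simp only [hF, ContinuousLinearMap.rotation_apply, Real.cos_neg, Real.sin_neg, neg_neg]
        have e1 : τ • (Real.cos θ • w + -Real.sin θ • v) =
            (τ * Real.cos θ) • w - (a * Real.cos θ) • v := by
          rw [smul_add, smul_smul, smul_smul, h1, neg_smul, sub_eq_add_neg]
        have e2 : (τ * Real.cos θ) • w - (a * Real.cos θ) • v +
            a • (Real.sin θ • w + Real.cos θ • v) = (a / Real.sin θ) • w := by
          rw [← h2, smul_add, smul_smul, smul_smul, add_smul]; abel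
        rw [e1, e2]
    _ = _ := by simp

/-- The mass of a fixed ball depends continuously on the scale from below. -/
lemma tendsto_stdGaussian_map_smul_ball {a : ℝ} (ha : 0 < a) (r : ℝ) :
    Filter.Tendsto (fun n : ℕ =>
        ((stdGaussian E).map fun x => (a * (1 - 1 / ((n : ℝ) + 2))) • x) (Metric.closedBall 0 r))
      Filter.atTop (nhds (((stdGaussian E).map fun x => a • x) (Metric.closedBall 0 r))) := by
  have hpos (n : ℕ) : 0 ≤ a * (1 - 1 / ((n : ℝ) + 2)) := by
    have : 1 / ((n : ℝ) + 2) ≤ 1 := by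
      rw [div_le_one (by positivity)]; linarith [(Nat.cast_nonneg n : (0 : ℝ) ≤ n)]
    exact mul_nonneg ha.le (by linarith)
  have hmap (s : ℝ) (hs : 0 ≤ s) : ((stdGaussian E).map fun x => s • x) (Metric.closedBall 0 r) =
      stdGaussian E {x | s * ‖x‖ ≤ r} := by
    rw [Measure.map_apply (by fun_prop) Metric.isClosed_closedBall.measurableSet]
    congr 1
    ext x
    simp [norm_smul, abs_of_nonneg hs]
  have hlim : Filter.Tendsto (fun n : ℕ => a * (1 - 1 / ((n : ℝ) + 2))) Filter.atTop (nhds a) := by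
    have h : Filter.Tendsto (fun n : ℕ => (n : ℝ) + 2) Filter.atTop Filter.atTop :=
      Filter.tendsto_atTop_add_const_right _ _ tendsto_natCast_atTop_atTop
    simpa using (h.const_div_atTop 1).const_sub 1 |>.const_mul a
  have hle (n : ℕ) : a * (1 - 1 / ((n : ℝ) + 2)) ≤ a := by
    have : 0 ≤ 1 / ((n : ℝ) + 2) := by positivity
    exact mul_le_of_le_one_right ha.le (by linarith)
  rw [hmap a ha.le]
  simp_rw [fun n : ℕ => hmap _ (hpos n)]
  -- The scales increase to `a`, so these events decrease to the limiting one.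
  have hI : {x : E | a * ‖x‖ ≤ r} = ⋂ n : ℕ, {x : E | a * (1 - 1 / ((n : ℝ) + 2)) * ‖x‖ ≤ r} := by
    ext x
    simp only [Set.mem_ofPred_eq, Set.mem_iInter]
    exact ⟨fun h n => (mul_le_mul_of_nonneg_right (hle n) (norm_nonneg x)).trans h,
      fun h => le_of_tendsto' (hlim.mul_const ‖x‖) h⟩
  rw [hI]
  refine tendsto_measure_iInter_atTop
    (fun n => (measurableSet_le (by fun_prop) measurable_const).nullMeasurableSet)
    (fun i j hij x hx => ?_) ⟨0, measure_ne_top _ _⟩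
  change _ ≤ r at hx ⊢
  refine le_trans ?_ hx
  have : (i : ℝ) ≤ j := by exact_mod_cast hij
  have h3 : 1 / ((j : ℝ) + 2) ≤ 1 / ((i : ℝ) + 2) := by gcongr
  gcongr

/-- A randomized map sending `N(u, a²)` close to `N(u, b²)` for all `u` incurs at least the total
variation error of the identity map. -/
lemma tvDist_le_of_forall_ball_le (T : Kernel E E) [IsMarkovKernel T] {a b : ℝ} (hb : 0 < b)
    (hab : b ≤ a) {ε : ℝ≥0∞}
    (h : ∀ (u : E) (r : ℝ), ((stdGaussian E).map fun x => b • x) (Metric.closedBall 0 r) ≤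
      (T ∘ₘ (stdGaussian E).map fun x => u + a • x) (Metric.closedBall u r) + ε) :
    tvDist ((stdGaussian E).map fun x => b • x) ((stdGaussian E).map fun x => a • x) ≤ ε := by
  have ha : 0 < a := hb.trans_le hab
  obtain ⟨r, hr⟩ := exists_ball_maximizing (E := E) hb hab
  have hbound : ((stdGaussian E).map fun x => b • x) (Metric.closedBall 0 r) ≤
      ((stdGaussian E).map fun x => a • x) (Metric.closedBall 0 r) + ε := by
    refine ge_of_tendsto' ((tendsto_stdGaussian_map_smul_ball ha r).add_const ε) fun n => ?_
    -- The shift by 2 keeps `c` strictly between 0 and 1, so `arccos c` has positive sine and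
    -- cosine; `c → 1` makes the prior scale tend to infinity.
    set c := 1 - 1 / ((n : ℝ) + 2) with hc
    have hn : 1 / ((n : ℝ) + 2) < 1 := by
      rw [div_lt_one (by positivity)]; linarith [(Nat.cast_nonneg n : (0 : ℝ) ≤ n)]
    have hn' : 0 < 1 / ((n : ℝ) + 2) := by positivity
    have hcos : Real.cos (Real.arccos c) = c := Real.cos_arccos (by linarith) (by linarith)
    have hsin : 0 < Real.sin (Real.arccos c) := by
      rw [Real.sin_arccos]
      exact Real.sqrt_pos.2 (by nlinarith)
    have hB := bayes_ball_le T ha (θ := Real.arccos c) (by rw [hcos]; linarith) hsin r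
    rw [hcos] at hB
    calc ((stdGaussian E).map fun x => b • x) (Metric.closedBall 0 r)
        = ∫⁻ _, ((stdGaussian E).map fun x => b • x) (Metric.closedBall 0 r) ∂(stdGaussian E) := by
          simp
      _ ≤ ∫⁻ z, ((T ∘ₘ (stdGaussian E).map
            fun x => (a * c / Real.sin (Real.arccos c)) • z + a • x)
            (Metric.closedBall ((a * c / Real.sin (Real.arccos c)) • z) r) + ε)
              ∂(stdGaussian E) := lintegral_mono fun z => h _ r
      _ ≤ _ := by
          rw [lintegral_add_right _ measurable_const]
          simpa using add_le_add_left hB ε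
  -- The maximizing ball dominates every event `B`; in `ℝ≥0∞` its mass under scale `a` is added and
  -- then cancelled rather than subtracted.
  refine tvDist_le_iff.2 fun B hB => ?_
  refine (ENNReal.add_le_add_iff_right (measure_ne_top
    ((stdGaussian E).map fun x => a • x) (Metric.closedBall 0 r))).1 ((hr B hB).trans ?_)
  rw [add_assoc, add_comm ε]
  gcongr

end BayesRisk

/-! ### Sufficiency and the two bounds in the location model -/

section GaussianLocation

open scoped MatrixOrder

variable {d : ℕ}

lemma tvDist_congr {Ω : Type*} [MeasurableSpace Ω] {P P' Q Q' : Measure Ω} [IsFiniteMeasure P]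
    [IsFiniteMeasure P'] [IsFiniteMeasure Q] [IsFiniteMeasure Q'] (hP : P = P') (hQ : Q = Q') :
    tvDist P Q = tvDist P' Q' := by
  subst hP hQ; rfl

lemma kernel_comp_map {Ω Ω' Ω'' : Type*} [MeasurableSpace Ω] [MeasurableSpace Ω']
    [MeasurableSpace Ω''] (κ : Kernel Ω' Ω'') {f : Ω → Ω'} (hf : Measurable f) (μ : Measure Ω) :
    κ ∘ₘ μ.map f = κ.comap f hf ∘ₘ μ := by
  rw [← Kernel.comp_deterministic_eq_comap, ← Measure.comp_assoc,
    Measure.deterministic_comp_eq_map]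

/-- The linear map `S^{1/2}`. -/
noncomputable def sqrtCLM (S : Matrix (Fin d) (Fin d) ℝ) :
    EuclideanSpace ℝ (Fin d) →L[ℝ] EuclideanSpace ℝ (Fin d) :=
  Matrix.toEuclideanCLM (𝕜 := ℝ) (CFC.sqrt S)

lemma exists_sqrtCLM_inverse {S : Matrix (Fin d) (Fin d) ℝ} (hS : S.PosDef) :
    ∃ R : EuclideanSpace ℝ (Fin d) →L[ℝ] EuclideanSpace ℝ (Fin d),
      (∀ x, R (sqrtCLM S x) = x) ∧ ∀ x, sqrtCLM S (R x) = x := by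
  have h : IsUnit (CFC.sqrt S) := by
    have h1 : IsUnit (CFC.sqrt S * CFC.sqrt S) := by
      rw [CFC.sqrt_mul_sqrt_self _ hS.posSemidef.nonneg]; exact hS.isUnit
    exact (isUnit_pow_iff two_ne_zero).1 (by rwa [sq])
  obtain ⟨v, hv⟩ := h.map (Matrix.toEuclideanCLM (𝕜 := ℝ) (n := Fin d))
  refine ⟨↑v⁻¹, fun x => ?_, fun x => ?_⟩
  · rw [sqrtCLM, ← hv, ← mul_apply_eq_comp, Units.inv_mul,
      one_apply_eq_self]
  · rw [sqrtCLM, ← hv, ← mul_apply_eq_comp, Units.mul_inv,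
      one_apply_eq_self]

lemma multivariateGaussian_smul_one {c : ℝ} (hc : 0 ≤ c) :
    multivariateGaussian (0 : EuclideanSpace ℝ (Fin d)) (c • (1 : Matrix (Fin d) (Fin d) ℝ)) =
      (stdGaussian (EuclideanSpace ℝ (Fin d))).map fun x => √c • x := by
  have hsqrt : CFC.sqrt (c • (1 : Matrix (Fin d) (Fin d) ℝ)) = √c • 1 := by
    refine CFC.sqrt_unique ?_ ?_
    · rw [smul_mul_smul_comm, Real.mul_self_sqrt hc, one_mul]
    · exact Matrix.nonneg_iff_posSemidef.2 (Matrix.PosSemidef.one.smul (Real.sqrt_nonneg c))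
  rw [multivariateGaussian, hsqrt]
  congr 1
  ext1 x
  rw [map_smul, map_one, zero_add, smul_apply,
    one_apply_eq_self]

lemma coe_normal (θ : EuclideanSpace ℝ (Fin d)) (S : Matrix (Fin d) (Fin d) ℝ) :
    (normal θ S : Measure (EuclideanSpace ℝ (Fin d))) =
      (stdGaussian (EuclideanSpace ℝ (Fin d))).map fun x => θ + sqrtCLM S x := rfl

instance isGaussian_normal (θ : EuclideanSpace ℝ (Fin d)) (S : Matrix (Fin d) (Fin d) ℝ) :
    IsGaussian (normal θ S : Measure (EuclideanSpace ℝ (Fin d))) :=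
  isGaussian_multivariateGaussian

lemma iidLaw_normal (θ : EuclideanSpace ℝ (Fin d)) (S : Matrix (Fin d) (Fin d) ℝ) (k : ℕ) :
    iidLaw (normal θ S) k =
      (Measure.pi fun _ : Fin k => stdGaussian (EuclideanSpace ℝ (Fin d))).map
        fun z i => θ + sqrtCLM S (z i) := by
  have (i : Fin k) : SigmaFinite ((stdGaussian (EuclideanSpace ℝ (Fin d))).map
      fun x => θ + sqrtCLM S x) := by
    rw [← coe_normal]; infer_instance
  exact (Measure.pi_map_pi (μ := fun _ : Fin k => stdGaussian (EuclideanSpace ℝ (Fin d)))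
    (f := fun _ x => θ + sqrtCLM S x) fun _ => by fun_prop).symm

lemma sampleMean_affine {k : ℕ} (hk : 0 < k) (θ : EuclideanSpace ℝ (Fin d))
    (A : EuclideanSpace ℝ (Fin d) →L[ℝ] EuclideanSpace ℝ (Fin d))
    (z : Fin k → EuclideanSpace ℝ (Fin d)) :
    sampleMean k (fun i => θ + A (z i)) = θ + A (sampleMean k z) := by
  have hk' : (k : ℝ) ≠ 0 := by exact_mod_cast hk.ne'
  simp only [sampleMean, Finset.sum_add_distrib, Finset.sum_const, Finset.card_univ,
    Fintype.card_fin, smul_add, map_smul, map_sum, ← Nat.cast_smul_eq_nsmul ℝ, smul_smul,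
    inv_mul_cancel₀ hk', one_smul]

lemma map_sampleMean_iidLaw (θ : EuclideanSpace ℝ (Fin d)) (S : Matrix (Fin d) (Fin d) ℝ) {k : ℕ}
    (hk : 0 < k) :
    (iidLaw (normal θ S) k).map (sampleMean k) =
      ((stdGaussian (EuclideanSpace ℝ (Fin d))).map fun x => (√k)⁻¹ • x).map
        fun x => θ + sqrtCLM S x := by
  rw [iidLaw_normal, Measure.map_map (measurable_sampleMean k) (by fun_prop),
    ← map_sampleMean_stdGaussian hk, Measure.map_map (by fun_prop) (measurable_sampleMean k)]
  congr 1
  ext1 z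
  exact sampleMean_affine hk θ _ z

/-- The conditional law, given their mean, of `k` samples from a Gaussian location model: the
prescribed mean plus independent residuals. -/
noncomputable def meanConditional (S : Matrix (Fin d) (Fin d) ℝ) (k : ℕ) :
    Kernel (EuclideanSpace ℝ (Fin d)) (Fin k → EuclideanSpace ℝ (Fin d)) :=
  (Kernel.id ×ₖ Kernel.const _ (iidLaw (normal 0 S) k)).map
    fun p i => p.1 + (p.2 i - sampleMean k p.2)

lemma measurable_recenter (k : ℕ) :
    Measurable fun (p : EuclideanSpace ℝ (Fin d) × (Fin k → EuclideanSpace ℝ (Fin d))) i =>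
      p.1 + (p.2 i - sampleMean k p.2) := by
  have := measurable_sampleMean (d := d) k
  fun_prop

instance isMarkovKernel_meanConditional (S : Matrix (Fin d) (Fin d) ℝ) (k : ℕ) :
    IsMarkovKernel (meanConditional S k) :=
  Kernel.IsMarkovKernel.map _ (measurable_recenter k)

/-- Residuals are unchanged by translating the sample, so their law is the same for every `θ`. This
is what frees the kernel from the parameter. -/
lemma meanConditional_apply (S : Matrix (Fin d) (Fin d) ℝ) {k : ℕ} (hk : 0 < k)
    (θ t : EuclideanSpace ℝ (Fin d)) :
    meanConditional S k t =
      (iidLaw (normal θ S) k).map fun z i => t + (z i - sampleMean k z) := by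
  have hm := measurable_sampleMean (d := d) k
  have hz : Measurable fun (z : Fin k → EuclideanSpace ℝ (Fin d)) i =>
      t + (z i - sampleMean k z) := by fun_prop
  rw [meanConditional, Kernel.map_apply _ (measurable_recenter k), Kernel.prod_apply,
    Kernel.id_apply, Kernel.const_apply, Measure.dirac_prod,
    Measure.map_map (measurable_recenter k) (by fun_prop), iidLaw_normal, iidLaw_normal,
    Measure.map_map hz (by fun_prop),
    Measure.map_map ((measurable_recenter k).comp (by fun_prop)) (by fun_prop)]
  congr 1
  ext1 z
  funext i
  simp only [Function.comp_apply, sampleMean_affine hk]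
  abel

lemma isCondLawGiven_meanConditional (S : Matrix (Fin d) (Fin d) ℝ) {k : ℕ} (hk : 0 < k)
    (θ : EuclideanSpace ℝ (Fin d)) :
    IsCondLawGiven (iidLaw (normal θ S) k) (sampleMean k) (meanConditional S k) := by
  have hG := measurable_fst.prodMk (measurable_recenter (d := d) k)
  rw [IsCondLawGiven, iidLaw, map_sampleMean_prodMk _ hk]
  ext B hB
  rw [Measure.compProd_apply hB, Measure.map_apply hG hB, Measure.prod_apply (hG hB)]
  refine lintegral_congr fun t => ?_
  have hz : Measurable fun (z : Fin k → EuclideanSpace ℝ (Fin d)) i =>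
      t + (z i - sampleMean k z) := (measurable_recenter k).comp (measurable_prodMk_left (x := t))
  rw [meanConditional_apply S hk θ, Measure.map_apply hz (measurable_prodMk_left hB)]
  rfl

lemma IsCondLawGiven.comp_eq {Ω 𝓣 : Type*} [MeasurableSpace Ω] [MeasurableSpace 𝓣]
    {P : Measure Ω} [IsFiniteMeasure P] {T : Ω → 𝓣} (hT : Measurable T) {K : Kernel 𝓣 Ω}
    [IsMarkovKernel K] (h : IsCondLawGiven P T K) : K ∘ₘ P.map T = P := by
  rw [← Measure.snd_compProd, ← h, Measure.snd, Measure.map_map measurable_snd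
    (hT.prodMk measurable_id')]
  exact Measure.map_id

lemma volume_eq_zero_iff_stdGaussian_map_smul {s : ℝ} (hs : s ≠ 0)
    {B : Set (EuclideanSpace ℝ (Fin d))} :
    ((stdGaussian (EuclideanSpace ℝ (Fin d))).map fun x => s • x) B = 0 ↔ volume B = 0 := by
  rw [stdGaussian_map_smul_eq_withDensity hs]
  refine ⟨fun h => ?_, fun h => withDensity_absolutelyContinuous _ _ h⟩
  refine withDensity_absolutelyContinuous' (f := fun x : EuclideanSpace ℝ (Fin d) =>
    ENNReal.ofReal (radialDensity (EuclideanSpace ℝ (Fin d)) s ‖x‖))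
    (by unfold radialDensity; fun_prop) (Filter.Eventually.of_forall fun x => ?_) h
  have : 0 < radialDensity (EuclideanSpace ℝ (Fin d)) s ‖x‖ := by
    unfold radialDensity
    have : 0 < s ^ 2 := by positivity
    have := Real.pi_pos
    positivity
  exact (ENNReal.ofReal_pos.2 this).ne'

/-- After whitening, the two laws differ by a translation; the Gaussian has the null sets of
Lebesgue measure, which is translation invariant. Invertibility of `S^{1/2}` turns the shift `θ -
θ'` into a whitened one. -/
lemma map_sampleMean_absolutelyContinuous {S : Matrix (Fin d) (Fin d) ℝ} (hS : S.PosDef) {k : ℕ}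
    (hk : 0 < k) (θ θ' : EuclideanSpace ℝ (Fin d)) :
    (iidLaw (normal θ S) k).map (sampleMean k) ≪ (iidLaw (normal θ' S) k).map (sampleMean k) := by
  obtain ⟨R, -, hR⟩ := exists_sqrtCLM_inverse hS
  have hs : (√(k : ℝ))⁻¹ ≠ 0 := by positivity
  refine Measure.AbsolutelyContinuous.mk fun B hB h => ?_
  rw [map_sampleMean_iidLaw _ _ hk, Measure.map_apply (by fun_prop) hB,
    volume_eq_zero_iff_stdGaussian_map_smul hs] at h ⊢
  rw [← measure_preimage_add_right volume (R (θ - θ'))] at h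
  convert h using 2
  ext x
  simp only [Set.mem_preimage, map_add, hR]
  rw [show θ' + (sqrtCLM S x + (θ - θ')) = θ + sqrtCLM S x by abel]

/-- Versions under `θ₀` agree with `meanConditional` outside a null set for the mean, and that set
stays null under every `θ`. -/
lemma IsCondLawGiven.of_normal {S : Matrix (Fin d) (Fin d) ℝ} (hS : S.PosDef) {k : ℕ}
    (hk : 0 < k) {θ₀ : EuclideanSpace ℝ (Fin d)}
    {K : Kernel (EuclideanSpace ℝ (Fin d)) (Fin k → EuclideanSpace ℝ (Fin d))} [IsMarkovKernel K]
    (h : IsCondLawGiven (iidLaw (normal θ₀ S) k) (sampleMean k) K)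
    (θ : EuclideanSpace ℝ (Fin d)) :
    IsCondLawGiven (iidLaw (normal θ S) k) (sampleMean k) K := by
  have h₀ := isCondLawGiven_meanConditional S hk θ₀
  have hae := Kernel.ae_eq_of_compProd_eq (h.symm.trans h₀)
  exact (isCondLawGiven_meanConditional S hk θ).trans (Measure.compProd_congr
    ((map_sampleMean_absolutelyContinuous hS hk θ θ₀).ae_eq hae)).symm

/-- The sufficiency-based procedure attains the total variation distance between the laws of the
two sample means. -/
lemma amplificationError_sufficiencyProcedure_le {S : Matrix (Fin d) (Fin d) ℝ} {n m : ℕ}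
    (hn : 0 < n)
    {K : Kernel (EuclideanSpace ℝ (Fin d)) (Fin (n + m) → EuclideanSpace ℝ (Fin d))}
    [IsMarkovKernel K]
    (h : ∀ θ, IsCondLawGiven (iidLaw (normal θ S) (n + m)) (sampleMean (n + m)) K) :
    amplificationError (gaussianLocation S) (sufficiencyProcedure (n := n) K) ≤
      tvDist ((stdGaussian (EuclideanSpace ℝ (Fin d))).map fun x => (√((n + m : ℕ) : ℝ))⁻¹ • x)
        ((stdGaussian (EuclideanSpace ℝ (Fin d))).map fun x => (√(n : ℝ))⁻¹ • x) := by
  refine iSup₂_le fun P hP => ?_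
  obtain ⟨θ, rfl⟩ := hP
  have hmeas (k : ℕ) := measurable_sampleMean (d := d) k
  have hprob (k : ℕ) : IsProbabilityMeasure ((iidLaw (normal θ S) k).map (sampleMean k)) :=
    Measure.isProbabilityMeasure_map (hmeas k).aemeasurable
  have h1 : K ∘ₘ (iidLaw (normal θ S) (n + m)).map (sampleMean (n + m)) =
      iidLaw (normal θ S) (n + m) := (h θ).comp_eq (hmeas _)
  have h2 : K ∘ₘ (iidLaw (normal θ S) n).map (sampleMean n) =
      sufficiencyProcedure (n := n) K ∘ₘ iidLaw (normal θ S) n := kernel_comp_map K _ _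
  have haff : Measurable fun x => θ + sqrtCLM S x := by fun_prop
  have hprob' (s : ℝ) : IsProbabilityMeasure (((stdGaussian (EuclideanSpace ℝ (Fin d))).map
      fun x => s • x).map fun x => θ + sqrtCLM S x) :=
    Measure.isProbabilityMeasure_map haff.aemeasurable
  rw [tvDist_congr h1.symm h2.symm]
  refine (tvDist_comp_le K _ _).trans ?_
  rw [tvDist_congr (map_sampleMean_iidLaw θ S (by omega)) (map_sampleMean_iidLaw θ S hn)]
  exact tvDist_map_le haff _ _

/-- No randomized map beats the total variation distance between the laws of the two sample
means. -/
lemma le_amplificationError {S : Matrix (Fin d) (Fin d) ℝ} (hS : S.PosDef) {n m : ℕ}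
    (hn : 0 < n)
    (T : Kernel (Fin n → EuclideanSpace ℝ (Fin d)) (Fin (n + m) → EuclideanSpace ℝ (Fin d)))
    [IsMarkovKernel T] :
    tvDist ((stdGaussian (EuclideanSpace ℝ (Fin d))).map fun x => (√((n + m : ℕ) : ℝ))⁻¹ • x)
        ((stdGaussian (EuclideanSpace ℝ (Fin d))).map fun x => (√(n : ℝ))⁻¹ • x) ≤
      amplificationError (gaussianLocation S) T := by
  obtain ⟨R, hR, -⟩ := exists_sqrtCLM_inverse hS
  have hnm : 0 < n + m := by omega
  have hn' : (0 : ℝ) < n := by exact_mod_cast hn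
  have hA : Measurable (sqrtCLM S) := by fun_prop
  have hf : Measurable fun y : Fin (n + m) → EuclideanSpace ℝ (Fin d) =>
      R (sampleMean (n + m) y) := R.measurable.comp (measurable_sampleMean _)
  -- The induced kernel on whitened means: undo the whitening, simulate `n` samples with this mean,
  -- apply `T`, then whiten the output mean.
  have : IsMarkovKernel (((T ∘ₖ meanConditional S n).comap (sqrtCLM S) hA).map
      fun y => R (sampleMean (n + m) y)) := Kernel.IsMarkovKernel.map _ hf
  refine tvDist_le_of_forall_ball_le
    (((T ∘ₖ meanConditional S n).comap (sqrtCLM S) hA).map fun y => R (sampleMean (n + m) y))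
    (by positivity) (by gcongr; omega) fun u r => ?_
  have hball : MeasurableSet (Metric.closedBall u r) := Metric.isClosed_closedBall.measurableSet
  -- Simulating from the mean restores the i.i.d. law exactly, so `T` receives its genuine input at
  -- `θ = S^{1/2} u`.
  have hout : ((T ∘ₖ meanConditional S n).comap (sqrtCLM S) hA).map
        (fun y => R (sampleMean (n + m) y)) ∘ₘ
        (stdGaussian (EuclideanSpace ℝ (Fin d))).map (fun x => u + (√(n : ℝ))⁻¹ • x) =
      (T ∘ₘ iidLaw (normal (sqrtCLM S u) S) n).map fun y => R (sampleMean (n + m) y) := by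
    rw [← Measure.map_comp _ _ hf, ← kernel_comp_map, ← Measure.comp_assoc,
      ← (isCondLawGiven_meanConditional S hn (sqrtCLM S u)).comp_eq (measurable_sampleMean n),
      map_sampleMean_iidLaw _ _ hn, Measure.map_map hA (by fun_prop),
      Measure.map_map (by fun_prop) (by fun_prop)]
    congr 4
    ext1 x
    simp
  have hin : (iidLaw (normal (sqrtCLM S u) S) (n + m)).map
        (fun y => R (sampleMean (n + m) y)) (Metric.closedBall u r) =
      ((stdGaussian (EuclideanSpace ℝ (Fin d))).map fun x => (√((n + m : ℕ) : ℝ))⁻¹ • x)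
        (Metric.closedBall 0 r) := by
    rw [show (fun y => R (sampleMean (n + m) y)) = R ∘ sampleMean (d := d) (n + m) from rfl,
      ← Measure.map_map R.measurable (measurable_sampleMean _), map_sampleMean_iidLaw _ _ hnm,
      Measure.map_map R.measurable (by fun_prop), Measure.map_apply (by fun_prop) hball]
    congr 1
    ext x
    simp [hR, dist_eq_norm]
  rw [hout, ← hin, Measure.map_apply hf hball, Measure.map_apply hf hball]
  refine tvDist_le_iff.1 ?_ _ (hf hball)
  exact le_iSup₂ (f := fun P (_ : P ∈ gaussianLocation S) =>
    tvDist (iidLaw P (n + m)) (T ∘ₘ iidLaw P n)) (normal (sqrtCLM S u) S) ⟨_, rfl⟩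

lemma minimaxError_le {X : Type*} [MeasurableSpace X] (𝓟 : Set (ProbabilityMeasure X)) {n m : ℕ}
    (T : Kernel (Fin n → X) (Fin (n + m) → X)) [IsMarkovKernel T] :
    minimaxError 𝓟 n m ≤ amplificationError 𝓟 T :=
  iInf_le_of_le T (iInf_le_of_le inferInstance le_rfl)

lemma minimaxError_gaussianLocation {S : Matrix (Fin d) (Fin d) ℝ} (hS : S.PosDef) {n : ℕ}
    (hn : 0 < n) (m : ℕ) :
    minimaxError (gaussianLocation S) n m =
      tvDist ((stdGaussian (EuclideanSpace ℝ (Fin d))).map fun x => (√((n + m : ℕ) : ℝ))⁻¹ • x)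
        ((stdGaussian (EuclideanSpace ℝ (Fin d))).map fun x => (√(n : ℝ))⁻¹ • x) := by
  refine le_antisymm ?_ (le_iInf₂ fun T _ => le_amplificationError hS hn T)
  exact (minimaxError_le _ _).trans (amplificationError_sufficiencyProcedure_le hn
    (isCondLawGiven_meanConditional S (by omega)))

end GaussianLocation

end SampleAmplification

/-- Exact minimax error of sample amplification in the Gaussian location model. The second and third
parts: the conditional distribution of the samples given their mean can be chosen free of `θ`, and
any version of it, computed under any one member of the model, gives an exactly minimax
optimal sufficiency-based procedure. -/
theorem mainTheorem5 (d n m : ℕ) (hn : 0 < n) (S : Matrix (Fin d) (Fin d) ℝ) (hS : S.PosDef) :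
    SampleAmplification.minimaxError (SampleAmplification.gaussianLocation S) n m =
      SampleAmplification.tvDist
        (multivariateGaussian (0 : EuclideanSpace ℝ (Fin d))
          (((n : ℝ)⁻¹) • (1 : Matrix (Fin d) (Fin d) ℝ)))
        (multivariateGaussian (0 : EuclideanSpace ℝ (Fin d))
          (((n : ℝ) + (m : ℝ))⁻¹ • (1 : Matrix (Fin d) (Fin d) ℝ))) ∧
    (∃ K : Kernel (EuclideanSpace ℝ (Fin d)) (Fin (n + m) → EuclideanSpace ℝ (Fin d)),
      IsMarkovKernel K ∧ ∀ θ : EuclideanSpace ℝ (Fin d),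
        SampleAmplification.IsCondLawGiven
          (SampleAmplification.iidLaw (SampleAmplification.normal θ S) (n + m))
          (SampleAmplification.sampleMean (n + m)) K) ∧
    ∀ (θ₀ : EuclideanSpace ℝ (Fin d))
      (K : Kernel (EuclideanSpace ℝ (Fin d)) (Fin (n + m) → EuclideanSpace ℝ (Fin d)))
      [IsMarkovKernel K],
      SampleAmplification.IsCondLawGiven
          (SampleAmplification.iidLaw (SampleAmplification.normal θ₀ S) (n + m))
          (SampleAmplification.sampleMean (n + m)) K →
        SampleAmplification.amplificationError (SampleAmplification.gaussianLocation S)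
            (SampleAmplification.sufficiencyProcedure (n := n) K) =
          SampleAmplification.minimaxError (SampleAmplification.gaussianLocation S) n m := by
  refine ⟨?_, ⟨SampleAmplification.meanConditional S (n + m), inferInstance,
    SampleAmplification.isCondLawGiven_meanConditional S (by omega)⟩, fun θ₀ K _ hK => ?_⟩
  · rw [SampleAmplification.minimaxError_gaussianLocation hS hn, SampleAmplification.tvDist_comm]
    refine SampleAmplification.tvDist_congr ?_ ?_
    · rw [SampleAmplification.multivariateGaussian_smul_one (by positivity), Real.sqrt_inv]
    · rw [SampleAmplification.multivariateGaussian_smul_one (by positivity), Real.sqrt_inv,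
        Nat.cast_add]
  · refine le_antisymm ?_ (SampleAmplification.minimaxError_le _ _)
    rw [SampleAmplification.minimaxError_gaussianLocation hS hn]
    exact SampleAmplification.amplificationError_sufficiencyProcedure_le hn
      (hK.of_normal hS (by omega))
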